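/- Let $M$ be a smooth Riemannian manifold of dimension $n$, let $N \subset M$ be a smooth (immersed) submanifold with the induced metric, and let $p \in N$. Suppose that $T_pN$ is spanned by the values at $p$ of a family of pairwise commuting Killing fields of $N$. For a subspace $\mathcal V \subseteq T_pM$ of dimension $k+1$ and a unit vector $u \in \mathcal V$, let $$\mathrm{Ric}_k(u,\mathcal V)=\operatorname{trace}\bigl(\mathcal V\to\mathcal V,\ x\mapsto \mathrm{pr}_{\mathcal V}(R(x,u)u)\bigr)=\sum_{i=1}^k \sec(u,e_i),$$ where $R$ is the curvature tensor of $M$, $\mathrm{pr}_{\mathcal V}$ is the orthogonal projection of $T_pM$ onto $\mathcal V$, $\sec$ is the sectional curvature of $M$, and $e_1,\dots,e_k$ is any orthonormal basis of the orthogonal complement of $u$ in $\mathcal V$. Let $k \in \{1,\dots,n-2\}$, and suppose that $\mathrm{Ric}_k(u,\mathcal V)>0$ for every $(k+1)$-dimensional subspace $\mathcal V\subseteq T_pN$ and every unit vector $u\in\mathcal V$. Then $$\dim N \le \left\lfloor \frac{n+k}{2} \right\rfloor .$$ -/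

import Mathlib

open Bundle
open scoped Manifold ContDiff

set_option maxSynthPendingDepth 3

noncomputable section

namespace LocalSymmetryRank

/-! ### Riemannian metrics in coordinates

A metric in coordinates is a map `g : E → E →L[ℝ] E →L[ℝ] ℝ`, with `g x u v = g_x(u, v)`. -/

section Coordinates

variable {E : Type*} [NormedAddCommGroup E] [NormedSpace ℝ E]

/-- Christoffel symbols of the first kind: `christoffelFirst g x u v w` is
`(D_u g (v, w) + D_v g (u, w) - D_w g (u, v)) / 2`, the derivatives being taken at `x`. -/
def christoffelFirst (g : E → E →L[ℝ] E →L[ℝ] ℝ) (x : E) : E →L[ℝ] E →L[ℝ] E →L[ℝ] ℝ :=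
  letI D : E →L[ℝ] E →L[ℝ] E →L[ℝ] ℝ := fderiv ℝ g x
  letI flip : (E →L[ℝ] E →L[ℝ] ℝ) →L[ℝ] (E →L[ℝ] E →L[ℝ] ℝ) :=
    (ContinuousLinearMap.flipₗᵢ ℝ E E ℝ).toContinuousLinearEquiv.toContinuousLinearMap
  (1 / 2 : ℝ) • (D + D.flip - flip ∘L D.flip)

theorem christoffelFirst_apply (g : E → E →L[ℝ] E →L[ℝ] ℝ) (x u v w : E) :
    christoffelFirst g x u v w =
      (fderiv ℝ g x u v w + fderiv ℝ g x v u w - fderiv ℝ g x w u v) / 2 := by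
  simp [christoffelFirst]
  ring

/-- Christoffel symbols `Γ_x(u, v)`: the vector with
`g_x(Γ_x(u, v), w) = christoffelFirst g x u v w` for all `w`. -/
def christoffel (g : E → E →L[ℝ] E →L[ℝ] ℝ) (x : E) : E →L[ℝ] E →L[ℝ] E :=
  ContinuousLinearMap.compL ℝ E (E →L[ℝ] ℝ) E (g x).inverse ∘L christoffelFirst g x

theorem christoffel_apply (g : E → E →L[ℝ] E →L[ℝ] ℝ) (x u v : E) :
    christoffel g x u v = (g x).inverse (christoffelFirst g x u v) :=
  rfl

/-- The curvature tensor in coordinates, `R(u, v) w = ∇_u ∇_v w - ∇_v ∇_u w` for constant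
coordinate vector fields `u`, `v`, `w`, where `∇_u Y = D_u Y + Γ(u, Y)`. -/
def curvatureCoord (g : E → E →L[ℝ] E →L[ℝ] ℝ) (x u v w : E) : E :=
  fderiv ℝ (christoffel g) x u v w - fderiv ℝ (christoffel g) x v u w +
    christoffel g x u (christoffel g x v w) - christoffel g x v (christoffel g x u w)

theorem curvatureCoord_add (g : E → E →L[ℝ] E →L[ℝ] ℝ) (x u u' v w : E) :
    curvatureCoord g x (u + u') v w = curvatureCoord g x u v w + curvatureCoord g x u' v w := by
  simp only [curvatureCoord, map_add, add_apply]
  abel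

theorem curvatureCoord_smul (g : E → E →L[ℝ] E →L[ℝ] ℝ) (x : E) (c : ℝ) (u v w : E) :
    curvatureCoord g x (c • u) v w = c • curvatureCoord g x u v w := by
  simp only [curvatureCoord, map_smul, smul_apply, smul_add, smul_sub]

end Coordinates

/-! ### Curvature of a Riemannian manifold -/

section Curvature

variable {E : Type*} [NormedAddCommGroup E] [NormedSpace ℝ E]
  {M : Type*} [TopologicalSpace M] [ChartedSpace E M] [IsManifold 𝓘(ℝ, E) ∞ M]
  [RiemannianBundle (fun x : M ↦ TangentSpace 𝓘(ℝ, E) x)]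

/-- The Riemannian metric of `M` in the chart `φ` around `p`: the value at `x ∈ E` on `u, v` is
the inner product of `dφ⁻¹_x(u)` and `dφ⁻¹_x(v)` in the tangent space at `φ⁻¹(x)`. -/
def metricCoord (p : M) (x : E) : E →L[ℝ] E →L[ℝ] ℝ :=
  letI A : E →L[ℝ] TangentSpace 𝓘(ℝ, E) ((extChartAt 𝓘(ℝ, E) p).symm x) :=
    mfderiv 𝓘(ℝ, E) 𝓘(ℝ, E) (extChartAt 𝓘(ℝ, E) p).symm x
  letI G : TangentSpace 𝓘(ℝ, E) ((extChartAt 𝓘(ℝ, E) p).symm x) →L[ℝ]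
      TangentSpace 𝓘(ℝ, E) ((extChartAt 𝓘(ℝ, E) p).symm x) →L[ℝ] ℝ := innerSL ℝ
  G.bilinearComp A A

/-- The linear isomorphism `dφ_p : T_pM → E`, where `φ` is the chart around `p`. -/
def chartDeriv (p : M) : TangentSpace 𝓘(ℝ, E) p →L[ℝ] E :=
  mfderiv 𝓘(ℝ, E) 𝓘(ℝ, E) (extChartAt 𝓘(ℝ, E) p) p

/-- The curvature tensor `R(u, v) w` of the Levi-Civita connection of `M` at `p`, computed in the
chart `φ` around `p` and transported to `T_pM` by `dφ_p`; being a tensor, it does not depend on the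
chart. -/
def curvature (p : M) (u v w : TangentSpace 𝓘(ℝ, E) p) : TangentSpace 𝓘(ℝ, E) p :=
  (chartDeriv p).inverse
    (curvatureCoord (metricCoord p) (extChartAt 𝓘(ℝ, E) p p)
      (chartDeriv p u) (chartDeriv p v) (chartDeriv p w))

/-- The linear map `x ↦ R(x, u) u` on `T_pM`. -/
def jacobiOperator (p : M) (u : TangentSpace 𝓘(ℝ, E) p) :
    TangentSpace 𝓘(ℝ, E) p →ₗ[ℝ] TangentSpace 𝓘(ℝ, E) p where
  toFun x := curvature p x u u
  map_add' x y := by simp only [curvature, map_add, curvatureCoord_add]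
  map_smul' c x := by simp only [curvature, map_smul, curvatureCoord_smul, RingHom.id_apply]

variable [FiniteDimensional ℝ E] in
/-- The intermediate Ricci curvature `Ric_k(u, V)` of a `(k+1)`-dimensional subspace `V` of `T_pM`
and a unit vector `u ∈ V`: the trace of the endomorphism of `V` that sends `x` to the orthogonal
projection of `R(x, u) u` to `V`. -/
def intermediateRicci (p : M) (u : TangentSpace 𝓘(ℝ, E) p)
    (V : Submodule ℝ (TangentSpace 𝓘(ℝ, E) p)) : ℝ :=
  haveI : FiniteDimensional ℝ (TangentSpace 𝓘(ℝ, E) p) := inferInstanceAs (FiniteDimensional ℝ E)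
  LinearMap.trace ℝ V
    (V.orthogonalProjectionOnto.toLinearMap ∘ₗ jacobiOperator p u ∘ₗ V.subtype)

end Curvature

/-! ### Submanifolds and Killing fields -/

section Killing

variable {E : Type*} [NormedAddCommGroup E] [NormedSpace ℝ E]
  {N : Type*} [TopologicalSpace N] [ChartedSpace E N] [IsManifold 𝓘(ℝ, E) ∞ N]

/-- The metric that an immersion `i : N → M` into a Riemannian manifold induces on `N`. -/
def inducedMetric {F : Type*} [NormedAddCommGroup F] [NormedSpace ℝ F]
    {M : Type*} [TopologicalSpace M] [ChartedSpace F M] [IsManifold 𝓘(ℝ, F) ∞ M]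
    [RiemannianBundle (fun x : M ↦ TangentSpace 𝓘(ℝ, F) x)]
    (i : N → M) (x : N) (u v : TangentSpace 𝓘(ℝ, E) x) : ℝ :=
  inner ℝ (mfderiv 𝓘(ℝ, E) 𝓘(ℝ, F) i x u) (mfderiv 𝓘(ℝ, E) 𝓘(ℝ, F) i x v)

/-- `X` is a Killing field for the metric `h` on `N`: it is smooth and the Lie derivative of `h`
along `X` vanishes, i.e. `X (h(Y, Z)) = h([X, Y], Z) + h(Y, [X, Z])` for all vector fields `Y`
and `Z` (which may be defined locally). -/
structure IsKillingField (h : (x : N) → TangentSpace 𝓘(ℝ, E) x → TangentSpace 𝓘(ℝ, E) x → ℝ)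
    (X : (x : N) → TangentSpace 𝓘(ℝ, E) x) : Prop where
  smooth : ContMDiff 𝓘(ℝ, E) 𝓘(ℝ, E).tangent ∞ (fun x ↦ (⟨x, X x⟩ : TangentBundle 𝓘(ℝ, E) N))
  lieDerivative_eq_zero : ∀ (x : N) (Y Z : (x : N) → TangentSpace 𝓘(ℝ, E) x),
    ContMDiffAt 𝓘(ℝ, E) 𝓘(ℝ, E).tangent ∞
      (fun x ↦ (⟨x, Y x⟩ : TangentBundle 𝓘(ℝ, E) N)) x →
    ContMDiffAt 𝓘(ℝ, E) 𝓘(ℝ, E).tangent ∞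
      (fun x ↦ (⟨x, Z x⟩ : TangentBundle 𝓘(ℝ, E) N)) x →
    mfderiv 𝓘(ℝ, E) 𝓘(ℝ, ℝ) (fun y ↦ h y (Y y) (Z y)) x (X x) =
      h x (VectorField.mlieBracket 𝓘(ℝ, E) X Y x) (Z x) +
        h x (Y x) (VectorField.mlieBracket 𝓘(ℝ, E) X Z x)

end Killing

end LocalSymmetryRank

end

noncomputable section

/-! Commuting Killing fields differentiate each other's inner products to zero: in `X (h(Y, Z)) =
h([X, Y], Z) + h(Y, [X, Z])` both brackets vanish. By the Koszul formula the ambient covariant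
derivatives `∇_X Y` of such fields are therefore normal to `N`. Thus they define a second
fundamental form `α` at `p` satisfying the Gauss equation of a flat submanifold, `⟨R(x, u)u, x⟩ =
‖α(u, x)‖² - ⟨α(u, u), α(x, x)⟩` (`exists_secondFundamentalForm`).

The rest is linear algebra (`exists_submodule_forall_norm_sq_le_inner`). Let `u` minimize `‖α(u,
u)‖` among unit tangent vectors. The vectors `w ⊥ u` with `α(u, w) = 0` form a space of dimension at
least `d - (n - d) - 1`, which is at least `k` if the bound on `d` fails. Minimality forces `⟨α(u,
u), α(w, w)⟩ ≥ 0` for them, so the right side of the Gauss equation is nonpositive on a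
`(k+1)`-dimensional space containing `u`. Its trace `Ric_k` is then nonpositive, a contradiction.

The geometry is done in charts, with covariant derivatives of vector fields along the coordinate
expression `f` of the immersion; no connection on `N` is needed. -/

namespace LocalSymmetryRank

open Filter Topology

/-! ### Linear algebra of a symmetric bilinear map with normal values. -/

section NormalBilinear

variable {T : Type*} [NormedAddCommGroup T] [InnerProductSpace ℝ T]

theorem inner_nonneg_of_norm_le_norm_add_smul {a b : T}
    (h : ∀ s : ℝ, 0 ≤ s → ‖a‖ ≤ ‖a + s • b‖) : 0 ≤ inner ℝ a b := by
  by_contra! hab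
  have hb : 0 < ‖b‖ ^ 2 := by
    have : b ≠ 0 := by rintro rfl; simp at hab
    positivity
  -- This value of `s` minimizes `‖a + s • b‖`; if `⟨a, b⟩ < 0` the minimum lies below `‖a‖`.
  have hs : 0 ≤ -inner ℝ a b / ‖b‖ ^ 2 := div_nonneg (by linarith) hb.le
  have h1 := pow_le_pow_left₀ (norm_nonneg _) (h _ hs) 2
  rw [norm_add_sq_real, inner_smul_right, norm_smul, mul_pow, Real.norm_eq_abs, sq_abs] at h1
  have h2 : 2 * (-inner ℝ a b / ‖b‖ ^ 2 * inner ℝ a b) + (-inner ℝ a b / ‖b‖ ^ 2) ^ 2 * ‖b‖ ^ 2 =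
      -(inner ℝ a b ^ 2 / ‖b‖ ^ 2) := by
    field_simp
    ring
  have h3 : 0 < inner ℝ a b ^ 2 / ‖b‖ ^ 2 := div_pos (by nlinarith) hb
  linarith

theorem exists_submodule_le_finrank_eq {K W : Type*} [DivisionRing K] [AddCommGroup W] [Module K W]
    (P : Submodule K W) {k : ℕ} (hk : k ≤ Module.finrank K P) :
    ∃ Q ≤ P, Module.finrank K Q = k := by
  obtain ⟨f, hf⟩ := exists_linearIndependent_of_le_finrank hk
  refine ⟨Submodule.span K (Set.range fun j ↦ (f j : W)), ?_, ?_⟩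
  · rw [Submodule.span_le]
    rintro _ ⟨j, rfl⟩
    exact (f j).2
  · have h := finrank_span_eq_card (hf.map' P.subtype P.ker_subtype)
    rwa [Fintype.card_fin] at h

variable [FiniteDimensional ℝ T] (S : Submodule ℝ T) (α : S →ₗ[ℝ] S →ₗ[ℝ] T)

/-- Compactness of the unit sphere gives a minimizer; homogeneity of degree two extends the bound to
all vectors. -/
theorem exists_unit_forall_norm_mul_sq_le (hS : 0 < Module.finrank ℝ S) :
    ∃ u : S, ‖u‖ = 1 ∧ ∀ v, ‖α u u‖ * ‖v‖ ^ 2 ≤ ‖α v v‖ := by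
  have : Nontrivial S := Module.nontrivial_of_finrank_pos hS
  have hc : Continuous fun v : S ↦ ‖α v v‖ := by
    let β : S →L[ℝ] S →L[ℝ] T := LinearMap.toContinuousBilinearMap α
    have : (fun v : S ↦ ‖α v v‖) = fun v ↦ ‖β v v‖ := rfl
    rw [this]
    fun_prop
  obtain ⟨u, hu, hmin⟩ := (isCompact_sphere (0 : S) 1).exists_isMinOn
    (NormedSpace.sphere_nonempty.2 zero_le_one) hc.continuousOn
  refine ⟨u, by simpa using hu, fun v ↦ ?_⟩
  rcases eq_or_ne v 0 with rfl | hv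
  · simp
  have hv' : ‖v‖ ≠ 0 := norm_ne_zero_iff.2 hv
  have h := hmin (show ‖v‖⁻¹ • v ∈ Metric.sphere (0 : S) 1 by
    rw [mem_sphere_zero_iff_norm, norm_smul, norm_inv, norm_norm, inv_mul_cancel₀ hv'])
  simp only [Set.mem_ofPred_eq, map_smul, LinearMap.smul_apply, norm_smul, norm_inv, norm_norm] at h
  calc ‖α u u‖ * ‖v‖ ^ 2 ≤ (‖v‖⁻¹ * (‖v‖⁻¹ * ‖α v v‖)) * ‖v‖ ^ 2 := by gcongr
    _ = ‖α v v‖ := by field_simp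

theorem exists_submodule_forall_norm_sq_le_inner (hsymm : ∀ v w, α v w = α w v)
    (hα : ∀ v w, α v w ∈ Sᗮ) {k : ℕ}
    (hk : Module.finrank ℝ T + k + 1 ≤ 2 * Module.finrank ℝ S) :
    ∃ (u : S) (V : Submodule ℝ S), ‖u‖ = 1 ∧ u ∈ V ∧ Module.finrank ℝ V = k + 1 ∧
      ∀ x ∈ V, ‖α u x‖ ^ 2 ≤ inner ℝ (α u u) (α x x) := by
  have hST : Module.finrank ℝ S + Module.finrank ℝ Sᗮ = Module.finrank ℝ T :=
    S.finrank_add_finrank_orthogonal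
  obtain ⟨u, hu, hmin⟩ := exists_unit_forall_norm_mul_sq_le S α (by omega)
  have hu0 : u ≠ 0 := by rintro rfl; simp at hu
  -- The kernel consists of the `w ⊥ u` with `α u w = 0`. The target has dimension `dim T - dim S +
  -- 1`, so rank-nullity and `hk` leave a kernel of dimension at least `k`.
  let φ : S →ₗ[ℝ] Sᗮ × ℝ := ((α u).codRestrict Sᗮ (hα u)).prod (innerₛₗ ℝ u)
  have hφ : ∀ w ∈ LinearMap.ker φ, α u w = 0 ∧ inner ℝ u w = 0 := by
    intro w hw
    have h := LinearMap.mem_ker.1 hw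
    exact ⟨congrArg Subtype.val (congrArg Prod.fst h), congrArg Prod.snd h⟩
  have hker : k ≤ Module.finrank ℝ (LinearMap.ker φ) := by
    have h1 := LinearMap.finrank_range_add_finrank_ker φ
    have h2 := (LinearMap.range φ).finrank_le
    rw [Module.finrank_prod, Module.finrank_self] at h2
    omega
  obtain ⟨K, hK, hKk⟩ := exists_submodule_le_finrank_eq _ hker
  refine ⟨u, (ℝ ∙ u) ⊔ K, hu, Submodule.mem_sup_left (Submodule.mem_span_singleton_self u), ?_, ?_⟩
  · have hdisj : (ℝ ∙ u) ⊓ K = ⊥ := by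
      rw [eq_bot_iff]
      rintro x ⟨hx, hxK⟩
      obtain ⟨c, rfl⟩ := Submodule.mem_span_singleton.1 hx
      have := (hφ _ (hK hxK)).2
      rw [inner_smul_right, real_inner_self_eq_norm_sq, hu] at this
      have hc : c = 0 := by simpa using this
      simp [hc]
    have := Submodule.finrank_sup_add_finrank_inf_eq (ℝ ∙ u) K
    rw [hdisj, finrank_bot, finrank_span_singleton hu0, hKk] at this
    omega
  · intro x hx
    obtain ⟨y, hy, w, hw, rfl⟩ := Submodule.mem_sup.1 hx
    obtain ⟨c, rfl⟩ := Submodule.mem_span_singleton.1 hy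
    obtain ⟨huw, hort⟩ := hφ w (hK hw)
    -- Moving from `u` along `√s • w` adds `s • α w w` to `α u u`, since the cross terms vanish, and
    -- does not shorten the vector, since `w ⊥ u`. Minimality thus gives `‖α u u‖ ≤ ‖α u u + s • α w
    -- w‖`.
    have hpos : 0 ≤ inner ℝ (α u u) (α w w) := by
      refine inner_nonneg_of_norm_le_norm_add_smul fun s hs ↦ ?_
      have h := hmin (u + Real.sqrt s • w)
      have h1 : (1 : ℝ) ≤ ‖u + Real.sqrt s • w‖ ^ 2 := by
        rw [norm_add_sq_real, hu, inner_smul_right, hort]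
        nlinarith [sq_nonneg ‖Real.sqrt s • w‖]
      have h2 : α (u + Real.sqrt s • w) (u + Real.sqrt s • w) = α u u + s • α w w := by
        simp only [map_add, map_smul, LinearMap.add_apply, LinearMap.smul_apply, hsymm w u, huw]
        simp [smul_smul, Real.mul_self_sqrt hs]
      rw [h2] at h
      exact (le_mul_of_one_le_right (norm_nonneg _) h1).trans h
    have h3 : α u (c • u + w) = c • α u u := by simp [huw]
    have h4 : α (c • u + w) (c • u + w) = c ^ 2 • α u u + α w w := by
      simp only [map_add, map_smul, LinearMap.add_apply, LinearMap.smul_apply, hsymm w u, huw]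
      simp [sq, smul_smul]
    rw [h3, h4, inner_add_right, inner_smul_right, real_inner_self_eq_norm_sq, norm_smul, mul_pow,
      Real.norm_eq_abs, sq_abs]
    linarith

end NormalBilinear

/-! ### Levi-Civita calculus in coordinates and along a map. -/

section CoordinateCalculus

variable {F : Type*} [NormedAddCommGroup F] [NormedSpace ℝ F]
  {g : F → F →L[ℝ] F →L[ℝ] ℝ} {x : F}

theorem fderiv_metric_symm (hg : DifferentiableAt ℝ g x)
    (hsymm : ∀ᶠ z in 𝓝 x, ∀ u v, g z u v = g z v u) (w u v : F) :
    fderiv ℝ g x w u v = fderiv ℝ g x w v u := by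
  have key : ∀ a b : F, fderiv ℝ (fun z ↦ g z a b) x w = fderiv ℝ g x w a b := by
    intro a b
    have h := (hg.hasFDerivAt.clm_apply (hasFDerivAt_const a x)).clm_apply (hasFDerivAt_const b x)
    rw [h.fderiv]
    simp
  rw [← key u v, ← key v u]
  congr 1
  exact Filter.EventuallyEq.fderiv_eq (hsymm.mono fun z hz ↦ hz u v)

theorem christoffel_symm (hg : DifferentiableAt ℝ g x)
    (hsymm : ∀ᶠ z in 𝓝 x, ∀ u v, g z u v = g z v u) (u v : F) :
    christoffel g x u v = christoffel g x v u := by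
  rw [christoffel_apply, christoffel_apply]
  congr 1
  ext w
  rw [christoffelFirst_apply, christoffelFirst_apply, fderiv_metric_symm hg hsymm w u v]
  ring

theorem metric_christoffel (hinv : (g x).IsInvertible) (u v w : F) :
    g x (christoffel g x u v) w = christoffelFirst g x u v w := by
  rw [christoffel_apply]
  obtain ⟨e, he⟩ := hinv
  rw [← he, ContinuousLinearMap.inverse_equiv]
  simp

/-- Metric compatibility: in the sum of the two Christoffel symbols of the first kind all but one
derivative of `g` cancel. -/
theorem metric_christoffel_add (hg : DifferentiableAt ℝ g x)
    (hsymm : ∀ᶠ z in 𝓝 x, ∀ u v, g z u v = g z v u) (hinv : (g x).IsInvertible) (u v w : F) :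
    g x (christoffel g x u v) w + g x v (christoffel g x u w) = fderiv ℝ g x u v w := by
  rw [hsymm.self_of_nhds v, metric_christoffel hinv, metric_christoffel hinv,
    christoffelFirst_apply, christoffelFirst_apply, fderiv_metric_symm hg hsymm u w v,
    fderiv_metric_symm hg hsymm v u w, fderiv_metric_symm hg hsymm w u v]
  ring

set_option synthInstance.maxHeartbeats 400000 in
theorem contDiffAt_christoffel [CompleteSpace F] (hg : ContDiffAt ℝ ∞ g x)
    (hinv : (g x).IsInvertible) : ContDiffAt ℝ ∞ (christoffel g) x := by
  have hD : ContDiffAt ℝ ∞ (fderiv ℝ g) x := hg.fderiv_right (m := ∞) (by simp)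
  have hflip := (ContinuousLinearMap.flipₗᵢ ℝ F F (F →L[ℝ] ℝ)).toContinuousLinearEquiv.contDiff
    (n := ∞)
  have h1 : ContDiffAt ℝ ∞ (christoffelFirst g) x := by
    unfold christoffelFirst
    refine ContDiffAt.const_smul _ ((hD.add ?_).sub ?_)
    · exact hflip.contDiffAt.comp x hD
    · exact contDiffAt_const.clm_comp (hflip.contDiffAt.comp x hD)
  have h2 : ContDiffAt ℝ ∞ (fun z ↦ (g z).inverse) x := by
    obtain ⟨e, he⟩ := hinv
    have h := contDiffAt_map_inverse (𝕜 := ℝ) (n := ∞) e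
    rw [he] at h
    exact h.comp x hg
  unfold christoffel
  exact ((ContinuousLinearMap.compL ℝ F (F →L[ℝ] ℝ) F).contDiff.contDiffAt.comp x h2).clm_comp h1

variable {W : Type*} [NormedAddCommGroup W] [NormedSpace ℝ W] {f : W → F} {y : W}

/-- The covariant derivative along `f`, in the direction `v`, of a vector field `Y` along `f`. -/
def covDeriv (g : F → F →L[ℝ] F →L[ℝ] ℝ) (f : W → F) (Y : W → F) (v : W) (y : W) : F :=
  fderiv ℝ Y y v + christoffel g (f y) (fderiv ℝ f y v) (Y y)

theorem fderiv_metric_comp (hg : DifferentiableAt ℝ g (f y))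
    (hsymm : ∀ᶠ z in 𝓝 (f y), ∀ u v, g z u v = g z v u) (hinv : (g (f y)).IsInvertible)
    (hf : DifferentiableAt ℝ f y) {Y Z : W → F} (hY : DifferentiableAt ℝ Y y)
    (hZ : DifferentiableAt ℝ Z y) (v : W) :
    fderiv ℝ (fun z ↦ g (f z) (Y z) (Z z)) y v =
      g (f y) (covDeriv g f Y v y) (Z y) + g (f y) (Y y) (covDeriv g f Z v y) := by
  have h := ((hg.hasFDerivAt.comp y hf.hasFDerivAt).clm_apply hY.hasFDerivAt).clm_apply
    hZ.hasFDerivAt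
  have e := metric_christoffel_add hg hsymm hinv (fderiv ℝ f y v) (Y y) (Z y)
  erw [h.fderiv]
  simp only [covDeriv, map_add, add_apply, ContinuousLinearMap.comp_apply,
    ContinuousLinearMap.flip_apply, Function.comp_apply]
  rw [← e]
  ring

theorem hasFDerivAt_pushforward (hf : ContDiffAt ℝ ∞ f y) {X : W → W}
    (hX : DifferentiableAt ℝ X y) :
    HasFDerivAt (fun z ↦ fderiv ℝ f z (X z))
      ((fderiv ℝ f y).comp (fderiv ℝ X y) + (fderiv ℝ (fderiv ℝ f) y).flip (X y)) y := by
  have h1 : DifferentiableAt ℝ (fderiv ℝ f) y :=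
    (hf.fderiv_right (m := 1) (by norm_cast)).differentiableAt one_ne_zero
  exact h1.hasFDerivAt.clm_apply hX.hasFDerivAt

theorem fderiv_fderiv_symm (hf : ContDiffAt ℝ ∞ f y) (v w : W) :
    fderiv ℝ (fderiv ℝ f) y v w = fderiv ℝ (fderiv ℝ f) y w v :=
  (hf.isSymmSndFDerivAt (by simp; norm_cast)).eq v w

/-- The two sides differ by the pushforward of the Lie bracket, because the second derivative of `f`
is symmetric. -/
theorem fderiv_pushforward_comm (hf : ContDiffAt ℝ ∞ f y) {X Y : W → W}
    (hX : DifferentiableAt ℝ X y) (hY : DifferentiableAt ℝ Y y)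
    (hXY : VectorField.lieBracket ℝ X Y y = 0) :
    fderiv ℝ (fun z ↦ fderiv ℝ f z (Y z)) y (X y) =
      fderiv ℝ (fun z ↦ fderiv ℝ f z (X z)) y (Y y) := by
  rw [(hasFDerivAt_pushforward hf hX).fderiv, (hasFDerivAt_pushforward hf hY).fderiv]
  have : fderiv ℝ Y y (X y) = fderiv ℝ X y (Y y) := sub_eq_zero.1 hXY
  simp [this, fderiv_fderiv_symm hf (X y) (Y y)]

/-- Torsion-freeness along `f`. -/
theorem covDeriv_pushforward_comm (hg : DifferentiableAt ℝ g (f y))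
    (hsymm : ∀ᶠ z in 𝓝 (f y), ∀ u v, g z u v = g z v u)
    (hf : ContDiffAt ℝ ∞ f y) {X Y : W → W}
    (hX : DifferentiableAt ℝ X y) (hY : DifferentiableAt ℝ Y y)
    (hXY : VectorField.lieBracket ℝ X Y y = 0) :
    covDeriv g f (fun z ↦ fderiv ℝ f z (Y z)) (X y) y =
      covDeriv g f (fun z ↦ fderiv ℝ f z (X z)) (Y y) y := by
  rw [covDeriv, covDeriv, fderiv_pushforward_comm hf hX hY hXY, christoffel_symm hg hsymm]

theorem contDiffAt_covDeriv [CompleteSpace F] (hg : ContDiffAt ℝ ∞ g (f y))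
    (hinv : (g (f y)).IsInvertible) (hf : ContDiffAt ℝ ∞ f y) {X : W → W}
    (hX : ContDiffAt ℝ ∞ X y) {Y : W → F} (hY : ContDiffAt ℝ ∞ Y y) :
    ContDiffAt ℝ ∞ (fun z ↦ covDeriv g f Y (X z) z) y := by
  have h1 : ContDiffAt ℝ ∞ (fderiv ℝ Y) y := hY.fderiv_right (m := ∞) (by simp)
  have h2 : ContDiffAt ℝ ∞ (fderiv ℝ f) y := hf.fderiv_right (m := ∞) (by simp)
  exact (h1.clm_apply hX).add
    ((((contDiffAt_christoffel hg hinv).comp y hf).clm_apply (h2.clm_apply hX)).clm_apply hY)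

/-- The commutator of covariant derivatives along commuting vector fields is the curvature. -/
theorem covDeriv_covDeriv_sub [CompleteSpace F] (hg : ContDiffAt ℝ ∞ g (f y))
    (hsymm : ∀ᶠ z in 𝓝 (f y), ∀ u v, g z u v = g z v u)
    (hinv : (g (f y)).IsInvertible) (hf : ContDiffAt ℝ ∞ f y) {X Z : W → W}
    (hX : ContDiffAt ℝ ∞ X y) (hZ : ContDiffAt ℝ ∞ Z y) {Y : W → F} (hY : ContDiffAt ℝ ∞ Y y)
    (hXZ : VectorField.lieBracket ℝ X Z y = 0) :
    covDeriv g f (fun z ↦ covDeriv g f Y (Z z) z) (X y) y -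
      covDeriv g f (fun z ↦ covDeriv g f Y (X z) z) (Z y) y =
      curvatureCoord g (f y) (fderiv ℝ f y (X y)) (fderiv ℝ f y (Z y)) (Y y) := by
  have hXd : DifferentiableAt ℝ X y := hX.differentiableAt (by simp)
  have hZd : DifferentiableAt ℝ Z y := hZ.differentiableAt (by simp)
  have hYd : DifferentiableAt ℝ Y y := hY.differentiableAt (by simp)
  have hfd : DifferentiableAt ℝ f y := hf.differentiableAt (by simp)
  have hΓ : DifferentiableAt ℝ (christoffel g) (f y) :=
    (contDiffAt_christoffel hg hinv).differentiableAt (by simp)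
  -- Product rule for the iterated derivative. On antisymmetrizing, the second derivatives of `Y`
  -- cancel by symmetry and the derivatives of the direction fields cancel by commutation; only
  -- curvature terms remain.
  have key : ∀ V : W → W, DifferentiableAt ℝ V y → ∀ v,
      fderiv ℝ (fun z ↦ covDeriv g f Y (V z) z) y v =
        fderiv ℝ Y y (fderiv ℝ V y v) + fderiv ℝ (fderiv ℝ Y) y v (V y) +
        (christoffel g (f y) (fderiv ℝ f y (V y)) (fderiv ℝ Y y v) +
          (christoffel g (f y) (fderiv ℝ (fun z ↦ fderiv ℝ f z (V z)) y v) (Y y) +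
            fderiv ℝ (christoffel g) (f y) (fderiv ℝ f y v) (fderiv ℝ f y (V y)) (Y y))) := by
    intro V hV v
    have h1 := hasFDerivAt_pushforward hY hV
    have h2 := hasFDerivAt_pushforward hf hV
    have h3 := (((hΓ.hasFDerivAt.comp y hfd.hasFDerivAt).clm_apply h2).clm_apply hYd.hasFDerivAt)
    have h4 : HasFDerivAt (fun z ↦ covDeriv g f Y (V z) z) _ y := h1.add h3
    rw [h4.fderiv, h2.fderiv]
    simp
  have hD : fderiv ℝ Z y (X y) = fderiv ℝ X y (Z y) := sub_eq_zero.1 hXZ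
  have hT := fderiv_pushforward_comm hf hXd hZd hXZ
  have hΓs := christoffel_symm (hg.differentiableAt (by simp)) hsymm
  have hc : ∀ (V : W → F) v, covDeriv g f V v y =
      fderiv ℝ V y v + christoffel g (f y) (fderiv ℝ f y v) (V y) := fun _ _ ↦ rfl
  rw [hc (fun z ↦ covDeriv g f Y (Z z) z), hc (fun z ↦ covDeriv g f Y (X z) z), key Z hZd,
    key X hXd, hD, hT, fderiv_fderiv_symm hY (X y) (Z y),
    curvatureCoord]
  simp only [covDeriv, map_add]
  abel

end CoordinateCalculus

/-! ### Families with constant inner products: normality and the Gauss equation. -/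

section ParallelFields

variable {F : Type*} [NormedAddCommGroup F] [NormedSpace ℝ F]
  {W : Type*} [NormedAddCommGroup W] [NormedSpace ℝ W]

/-- `f` is smooth on the open set `U`, and `g` is a smooth nondegenerate symmetric form near
`f '' U`. -/
structure IsMetricAlong (g : F → F →L[ℝ] F →L[ℝ] ℝ) (f : W → F) (U : Set W) : Prop where
  isOpen : IsOpen U
  contDiffAt_map : ∀ y ∈ U, ContDiffAt ℝ ∞ f y
  contDiffAt_metric : ∀ y ∈ U, ContDiffAt ℝ ∞ g (f y)
  symm : ∀ y ∈ U, ∀ᶠ z in 𝓝 (f y), ∀ u v, g z u v = g z v u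
  isInvertible : ∀ y ∈ U, (g (f y)).IsInvertible

/-- Smooth pairwise commuting vector fields along which the inner products (for the metric induced
by `f`) of members of the family are constant. -/
structure IsParallelFamily (g : F → F →L[ℝ] F →L[ℝ] ℝ) (f : W → F) (U : Set W)
    (𝒳 : Set (W → W)) : Prop where
  contDiffAt : ∀ X ∈ 𝒳, ∀ y ∈ U, ContDiffAt ℝ ∞ X y
  lieBracket_eq_zero : ∀ X ∈ 𝒳, ∀ Y ∈ 𝒳, ∀ y ∈ U, VectorField.lieBracket ℝ X Y y = 0
  fderiv_metric_eq_zero : ∀ X ∈ 𝒳, ∀ Y ∈ 𝒳, ∀ Z ∈ 𝒳, ∀ y ∈ U,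
    fderiv ℝ (fun z ↦ g (f z) (fderiv ℝ f z (Y z)) (fderiv ℝ f z (Z z))) y (X y) = 0

variable {g : F → F →L[ℝ] F →L[ℝ] ℝ} {f : W → F} {U : Set W} {𝒳 : Set (W → W)}

theorem contDiffAt_pushforward {y : W} (hf : ContDiffAt ℝ ∞ f y) {X : W → W}
    (hX : ContDiffAt ℝ ∞ X y) : ContDiffAt ℝ ∞ (fun z ↦ fderiv ℝ f z (X z)) y :=
  (hf.fderiv_right (m := ∞) (by simp)).clm_apply hX

theorem IsMetricAlong.differentiableAt_metric_apply (hgf : IsMetricAlong g f U) {y : W}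
    (hy : y ∈ U) {Y Z : W → W} (hY : ContDiffAt ℝ ∞ Y y) (hZ : ContDiffAt ℝ ∞ Z y) :
    DifferentiableAt ℝ (fun z ↦ g (f z) (fderiv ℝ f z (Y z)) (fderiv ℝ f z (Z z))) y := by
  have hf := hgf.contDiffAt_map y hy
  exact ((((hgf.contDiffAt_metric y hy).comp y hf).clm_apply
    (contDiffAt_pushforward hf hY)).clm_apply (contDiffAt_pushforward hf hZ)).differentiableAt
      (by simp)

/-- All three conditions are linear over `ℝ` in each field. The passage to the span lets every
tangent vector at a point be extended to a field of the family once the values there span. -/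
theorem IsParallelFamily.span (hgf : IsMetricAlong g f U) (h : IsParallelFamily g f U 𝒳) :
    IsParallelFamily g f U (Submodule.span ℝ 𝒳 : Submodule ℝ (W → W)) := by
  have hsm : ∀ X ∈ Submodule.span ℝ 𝒳, ∀ y ∈ U, ContDiffAt ℝ ∞ X y := by
    intro X hX y hy
    induction hX using Submodule.span_induction with
    | mem X hX => exact h.contDiffAt X hX y hy
    | zero => exact contDiffAt_const
    | add X Y _ _ hX hY => exact hX.add hY
    | smul c X _ hX => exact contDiffAt_const.smul hX
  have hd : ∀ X ∈ Submodule.span ℝ 𝒳, ∀ y ∈ U, DifferentiableAt ℝ X y :=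
    fun X hX y hy ↦ (hsm X hX y hy).differentiableAt (by simp)
  refine ⟨hsm, ?_, ?_⟩
  · have h1 : ∀ X ∈ Submodule.span ℝ 𝒳, ∀ Y ∈ 𝒳, ∀ y ∈ U,
        VectorField.lieBracket ℝ X Y y = 0 := by
      intro X hX Y hY y hy
      induction hX using Submodule.span_induction with
      | mem X hX => exact h.lieBracket_eq_zero X hX Y hY y hy
      | zero => exact congrFun VectorField.lieBracket_zero_left y
      | add X Y hXm hYm hX hY =>
        rw [VectorField.lieBracket_add_left (hd X hXm y hy) (hd Y hYm y hy), hX, hY, add_zero]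
      | smul c X hXm hX => rw [VectorField.lieBracket_const_smul_left (hd X hXm y hy), hX, smul_zero]
    intro X hX Y hY y hy
    induction hY using Submodule.span_induction with
    | mem Y hY => exact h1 X hX Y hY y hy
    | zero => exact congrFun VectorField.lieBracket_zero_right y
    | add Y Z hYm hZm hY hZ =>
      rw [VectorField.lieBracket_add_right (hd Y hYm y hy) (hd Z hZm y hy), hY, hZ, add_zero]
    | smul c Y hYm hY => rw [VectorField.lieBracket_const_smul_right (hd Y hYm y hy), hY, smul_zero]
  · intro X hX Y hY Z hZ y hy
    have hsub := Submodule.subset_span (R := ℝ) (s := 𝒳)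
    have hq : ∀ Y ∈ Submodule.span ℝ 𝒳, ∀ Z ∈ Submodule.span ℝ 𝒳, DifferentiableAt ℝ
        (fun z ↦ g (f z) (fderiv ℝ f z (Y z)) (fderiv ℝ f z (Z z))) y := fun Y hY Z hZ ↦
      hgf.differentiableAt_metric_apply hy (hsm Y hY y hy) (hsm Z hZ y hy)
    have h1 : ∀ X ∈ Submodule.span ℝ 𝒳, ∀ Y ∈ 𝒳, ∀ Z ∈ 𝒳, fderiv ℝ (fun z ↦
        g (f z) (fderiv ℝ f z (Y z)) (fderiv ℝ f z (Z z))) y (X y) = 0 := by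
      intro X hX Y hY Z hZ
      induction hX using Submodule.span_induction with
      | mem X hX => exact h.fderiv_metric_eq_zero X hX Y hY Z hZ y hy
      | zero => simp
      | add X X' _ _ hX hX' => simp [hX, hX']
      | smul c X _ hX => simp [hX]
    have h2 : ∀ X ∈ Submodule.span ℝ 𝒳, ∀ Y ∈ Submodule.span ℝ 𝒳, ∀ Z ∈ 𝒳, fderiv ℝ (fun z ↦
        g (f z) (fderiv ℝ f z (Y z)) (fderiv ℝ f z (Z z))) y (X y) = 0 := by
      intro X hX Y hY Z hZ
      induction hY using Submodule.span_induction with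
      | mem Y hY => exact h1 X hX Y hY Z hZ
      | zero => simp
      | add Y Y' hYm hYm' hY hY' =>
        simp only [Pi.add_apply, map_add, add_apply]
        rw [fderiv_fun_add (hq Y hYm Z (hsub hZ)) (hq Y' hYm' Z (hsub hZ)), add_apply, hY, hY',
          add_zero]
      | smul c Y hYm hY =>
        simp only [Pi.smul_apply, map_smul, smul_apply]
        rw [fderiv_fun_const_smul (hq Y hYm Z (hsub hZ)), smul_apply, hY, smul_zero]
    induction hZ using Submodule.span_induction with
    | mem Z hZ => exact h2 X hX Y hY Z hZ
    | zero => simp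
    | add Z Z' hZm hZm' hZ hZ' =>
      simp only [Pi.add_apply, map_add]
      rw [fderiv_fun_add (hq Y hY Z hZm) (hq Y hY Z' hZm'), add_apply, hZ, hZ', add_zero]
    | smul c Z hZm hZ =>
      simp only [Pi.smul_apply, map_smul]
      rw [fderiv_fun_const_smul (hq Y hY Z hZm), smul_apply, hZ, smul_zero]

variable {X Y Z V : W → W} {y : W}

theorem IsParallelFamily.covDeriv_comm (hgf : IsMetricAlong g f U) (h : IsParallelFamily g f U 𝒳)
    (hX : X ∈ 𝒳) (hY : Y ∈ 𝒳) (hy : y ∈ U) :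
    covDeriv g f (fun z ↦ fderiv ℝ f z (Y z)) (X y) y =
      covDeriv g f (fun z ↦ fderiv ℝ f z (X z)) (Y y) y :=
  covDeriv_pushforward_comm ((hgf.contDiffAt_metric y hy).differentiableAt (by simp))
    (hgf.symm y hy) (hgf.contDiffAt_map y hy) ((h.contDiffAt X hX y hy).differentiableAt (by simp))
    ((h.contDiffAt Y hY y hy).differentiableAt (by simp)) (h.lieBracket_eq_zero X hX Y hY y hy)

/-- The covariant derivatives of a parallel family are normal to it, by the Koszul formula. -/
theorem IsParallelFamily.metric_covDeriv_eq_zero (hgf : IsMetricAlong g f U)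
    (h : IsParallelFamily g f U 𝒳) (hX : X ∈ 𝒳) (hY : Y ∈ 𝒳) (hZ : Z ∈ 𝒳) (hy : y ∈ U) :
    g (f y) (covDeriv g f (fun z ↦ fderiv ℝ f z (Y z)) (X y) y) (fderiv ℝ f y (Z y)) = 0 := by
  have hf := hgf.contDiffAt_map y hy
  have hd : ∀ X ∈ 𝒳, DifferentiableAt ℝ (fun z ↦ fderiv ℝ f z (X z)) y := fun X hX ↦
    (contDiffAt_pushforward hf (h.contDiffAt X hX y hy)).differentiableAt (by simp)
  have hs := (hgf.symm y hy).self_of_nhds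
  -- `g(∇_X Y, Z)` is antisymmetric in `Y, Z` by metric compatibility and symmetric in `X, Y` by
  -- `covDeriv_comm`; three cyclic instances force it to vanish.
  have key : ∀ X ∈ 𝒳, ∀ Y ∈ 𝒳, ∀ Z ∈ 𝒳,
      g (f y) (covDeriv g f (fun z ↦ fderiv ℝ f z (Y z)) (X y) y) (fderiv ℝ f y (Z y)) +
      g (f y) (covDeriv g f (fun z ↦ fderiv ℝ f z (Z z)) (X y) y) (fderiv ℝ f y (Y y)) = 0 := by
    intro X hX Y hY Z hZ
    have h1 := fderiv_metric_comp ((hgf.contDiffAt_metric y hy).differentiableAt (by simp))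
      (hgf.symm y hy) (hgf.isInvertible y hy) (hf.differentiableAt (by simp)) (hd Y hY) (hd Z hZ)
      (X y)
    rw [h.fderiv_metric_eq_zero X hX Y hY Z hZ y hy, hs (fderiv ℝ f y (Y y))] at h1
    exact h1.symm
  have e1 := key X hX Y hY Z hZ
  have e2 := key Y hY Z hZ X hX
  have e3 := key Z hZ X hX Y hY
  rw [h.covDeriv_comm hgf hY hX hy, h.covDeriv_comm hgf hY hZ hy] at e2
  rw [h.covDeriv_comm hgf hZ hX hy] at e3
  linarith

/-- The Gauss equation for a parallel family. -/
theorem IsParallelFamily.metric_curvatureCoord [CompleteSpace F] (hgf : IsMetricAlong g f U)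
    (h : IsParallelFamily g f U 𝒳) (hX : X ∈ 𝒳) (hY : Y ∈ 𝒳) (hZ : Z ∈ 𝒳) (hV : V ∈ 𝒳)
    (hy : y ∈ U) :
    g (f y) (curvatureCoord g (f y) (fderiv ℝ f y (X y)) (fderiv ℝ f y (Y y))
      (fderiv ℝ f y (Z y))) (fderiv ℝ f y (V y)) =
    g (f y) (covDeriv g f (fun z ↦ fderiv ℝ f z (Z z)) (X y) y)
      (covDeriv g f (fun z ↦ fderiv ℝ f z (V z)) (Y y) y) -
    g (f y) (covDeriv g f (fun z ↦ fderiv ℝ f z (Z z)) (Y y) y)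
      (covDeriv g f (fun z ↦ fderiv ℝ f z (V z)) (X y) y) := by
  have hf := hgf.contDiffAt_map y hy
  have hg := hgf.contDiffAt_metric y hy
  have hT : ∀ X ∈ 𝒳, ContDiffAt ℝ ∞ (fun z ↦ fderiv ℝ f z (X z)) y := fun X hX ↦
    contDiffAt_pushforward hf (h.contDiffAt X hX y hy)
  -- Obtained by differentiating `g(∇_Y Z, V) = 0` along `X`; this uses normality on a neighbourhood
  -- of `y`, not only at `y`.
  have key : ∀ X ∈ 𝒳, ∀ Y ∈ 𝒳,
      g (f y) (covDeriv g f (fun z ↦ covDeriv g f (fun z ↦ fderiv ℝ f z (Z z)) (Y z) z) (X y) y)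
        (fderiv ℝ f y (V y)) =
      -g (f y) (covDeriv g f (fun z ↦ fderiv ℝ f z (Z z)) (Y y) y)
        (covDeriv g f (fun z ↦ fderiv ℝ f z (V z)) (X y) y) := by
    intro X hX Y hY
    have h1 := fderiv_metric_comp (hg.differentiableAt (by simp)) (hgf.symm y hy)
      (hgf.isInvertible y hy) (hf.differentiableAt (by simp))
      ((contDiffAt_covDeriv hg (hgf.isInvertible y hy) hf (h.contDiffAt Y hY y hy)
        (hT Z hZ)).differentiableAt (by simp))
      ((hT V hV).differentiableAt (by simp)) (X y)
    have h2 : (fun z ↦ g (f z) (covDeriv g f (fun z ↦ fderiv ℝ f z (Z z)) (Y z) z)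
        (fderiv ℝ f z (V z))) =ᶠ[𝓝 y] fun _ ↦ 0 := by
      filter_upwards [hgf.isOpen.mem_nhds hy] with z hz
      exact h.metric_covDeriv_eq_zero hgf hY hZ hV hz
    rw [h2.fderiv_eq, fderiv_fun_const] at h1
    simp only [Pi.zero_apply, zero_apply] at h1
    linarith
  rw [← covDeriv_covDeriv_sub hg (hgf.symm y hy) (hgf.isInvertible y hy) hf
    (h.contDiffAt X hX y hy) (h.contDiffAt Y hY y hy) (hT Z hZ)
    (h.lieBracket_eq_zero X hX Y hY y hy), map_sub, sub_apply, key X hX Y hY, key Y hY X hX]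
  ring

/-- A parallel family spanning at `y` has a second fundamental form there, which satisfies the
Gauss equation of a flat submanifold. -/
theorem IsParallelFamily.exists_bilinear [CompleteSpace F]
    (hgf : IsMetricAlong g f U) (h : IsParallelFamily g f U 𝒳) (hy : y ∈ U)
    (hspan : Submodule.span ℝ ((fun X : W → W ↦ X y) '' 𝒳) = ⊤) :
    ∃ α : W →ₗ[ℝ] W →ₗ[ℝ] F, (∀ v w, α v w = α w v) ∧
      (∀ v w u, g (f y) (α v w) (fderiv ℝ f y u) = 0) ∧
      ∀ v u, g (f y) (curvatureCoord g (f y) (fderiv ℝ f y v) (fderiv ℝ f y u)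
        (fderiv ℝ f y u)) (fderiv ℝ f y v) =
        g (f y) (α u v) (α u v) - g (f y) (α u u) (α v v) := by
  set P := Submodule.span ℝ 𝒳
  have hP := h.span hgf
  let ev : P →ₗ[ℝ] W := LinearMap.proj y ∘ₗ P.subtype
  have hev : LinearMap.range ev = ⊤ := by
    rw [LinearMap.range_comp, Submodule.range_subtype, Submodule.map_span]
    exact hspan
  -- A linear choice of extension of each vector at `y` to a field in the span. Linearity of `s`
  -- makes `α` additive in its second slot.
  obtain ⟨s, hs⟩ := ev.exists_rightInverse_of_surjective hev
  have hsy : ∀ w, (s w : W → W) y = w := fun w ↦ LinearMap.congr_fun hs w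
  have hmem : ∀ w, (s w : W → W) ∈ P := fun w ↦ (s w).2
  have hf := hgf.contDiffAt_map y hy
  have hT : ∀ w, DifferentiableAt ℝ (fun z ↦ fderiv ℝ f z ((s w : W → W) z)) y := fun w ↦
    (contDiffAt_pushforward hf (hP.contDiffAt _ (hmem w) y hy)).differentiableAt (by simp)
  let α : W →ₗ[ℝ] W →ₗ[ℝ] F := LinearMap.mk₂ ℝ
    (fun v w ↦ covDeriv g f (fun z ↦ fderiv ℝ f z ((s w : W → W) z)) v y)
    (fun v v' w ↦ by simp only [covDeriv, map_add, add_apply]; abel)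
    (fun c v w ↦ by simp only [covDeriv, map_smul, smul_apply, smul_add])
    (fun v w w' ↦ by
      simp only [covDeriv, map_add, Submodule.coe_add, Pi.add_apply]
      rw [fderiv_fun_add (hT w) (hT w'), add_apply]
      abel)
    (fun c v w ↦ by
      simp only [covDeriv, map_smul, Submodule.coe_smul, Pi.smul_apply]
      rw [fderiv_fun_const_smul (hT w), smul_apply, smul_add])
  have hα : ∀ v w, α v w =
      covDeriv g f (fun z ↦ fderiv ℝ f z ((s w : W → W) z)) ((s v : W → W) y) y := by
    intro v w
    rw [hsy]
    rfl
  have hsymm : ∀ v w, α v w = α w v := fun v w ↦ by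
    rw [hα, hα, hP.covDeriv_comm hgf (hmem v) (hmem w) hy]
  refine ⟨α, hsymm, fun v w u ↦ ?_, fun v u ↦ ?_⟩
  · have := hP.metric_covDeriv_eq_zero hgf (hmem v) (hmem w) (hmem u) hy
    rwa [← hα, hsy] at this
  · have := hP.metric_curvatureCoord hgf (hmem v) (hmem u) (hmem u) (hmem v) hy
    simp only [hsy] at this
    rw [this]
    change g (f y) (α v u) (α u v) - g (f y) (α u u) (α v v) = _
    rw [hsymm v u]

end ParallelFields

/-! ### Injectivity of the differential of an immersion. -/

section Immersion

variable {E F : Type*} [NormedAddCommGroup E] [NormedSpace ℝ E]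
  [NormedAddCommGroup F] [NormedSpace ℝ F]
  {M : Type*} [TopologicalSpace M] [ChartedSpace F M] [IsManifold 𝓘(ℝ, F) ∞ M]
  {N : Type*} [TopologicalSpace N] [ChartedSpace E N] [IsManifold 𝓘(ℝ, E) ∞ N]

theorem mfderiv_injective_of_isImmersionAt {i : N → M} {p : N}
    (hi : Manifold.IsImmersionAt 𝓘(ℝ, E) 𝓘(ℝ, F) ∞ i p) :
    Function.Injective (mfderiv 𝓘(ℝ, E) 𝓘(ℝ, F) i p) := by
  have : IsManifold 𝓘(ℝ, F) 1 M := IsManifold.of_le (n := ∞) (by norm_cast)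
  have : IsManifold 𝓘(ℝ, E) 1 N := IsManifold.of_le (n := ∞) (by norm_cast)
  set a := hi.domChart
  set b := hi.codChart
  have ha : a ∈ IsManifold.maximalAtlas 𝓘(ℝ, E) 1 N :=
    IsManifold.maximalAtlas_subset_of_le (n := ∞) (by norm_cast) hi.domChart_mem_maximalAtlas
  have hb : b ∈ IsManifold.maximalAtlas 𝓘(ℝ, F) 1 M :=
    IsManifold.maximalAtlas_subset_of_le (n := ∞) (by norm_cast) hi.codChart_mem_maximalAtlas
  have hpa : p ∈ a.source := hi.mem_domChart_source
  have hda := mdifferentiableAt_of_mem_maximalAtlas ha hpa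
  have hdb := mdifferentiableAt_of_mem_maximalAtlas hb hi.mem_codChart_source
  have hds := mdifferentiableAt_symm_of_mem_maximalAtlas ha (a.map_source hpa)
  have hdi : MDifferentiableAt 𝓘(ℝ, E) 𝓘(ℝ, F) i p := hi.contMDiffAt.mdifferentiableAt (by simp)
  have hinj : Function.Injective (mfderiv 𝓘(ℝ, E) 𝓘(ℝ, E) a p) := by
    have h1 : a.symm ∘ a =ᶠ[𝓝 p] id := a.eventually_left_inverse hpa
    have h2 := mfderiv_comp p hds hda
    rw [h1.mfderiv_eq, mfderiv_id] at h2
    intro u v huv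
    have h3 := fun w : TangentSpace 𝓘(ℝ, E) p ↦ congrArg (fun L ↦ L w) h2
    have := (h3 u).trans ((congrArg (mfderiv 𝓘(ℝ, E) 𝓘(ℝ, E) a.symm (a p)) huv).trans (h3 v).symm)
    exact this
  -- In the charts adapted to the immersion, `i` is the injective linear map `u ↦ (u, 0)`.
  let j : E →L[ℝ] F := hi.equiv.toContinuousLinearMap ∘L ContinuousLinearMap.inl ℝ E hi.complement
  have hj : Function.Injective j := hi.equiv.injective.comp fun u v h ↦ congrArg Prod.fst h
  have heq : b ∘ i =ᶠ[𝓝 p] j ∘ a := by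
    filter_upwards [a.open_source.mem_nhds hpa] with x hx
    have h := hi.writtenInCharts (show a x ∈ (a.extend 𝓘(ℝ, E)).target by
      simpa using a.map_source hx)
    simp only [Function.comp_apply, OpenPartialHomeomorph.extend_coe,
      OpenPartialHomeomorph.extend_coe_symm, modelWithCornersSelf_coe,
      modelWithCornersSelf_coe_symm, id_eq] at h
    rw [show hi.domChart.symm (a x) = x from a.left_inv hx] at h
    exact h
  have h1 := mfderiv_comp p hdb hdi
  have hdj : MDifferentiableAt 𝓘(ℝ, E) 𝓘(ℝ, F) j (a p) := j.mdifferentiableAt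
  have h2 := mfderiv_comp p hdj hda
  rw [heq.mfderiv_eq, h2, ContinuousLinearMap.mfderiv_eq] at h1
  intro u v huv
  apply hinj
  apply hj
  have h3 := fun w : TangentSpace 𝓘(ℝ, E) p ↦ congrArg (fun L ↦ L w) h1
  exact (h3 u).trans ((congrArg (mfderiv 𝓘(ℝ, F) 𝓘(ℝ, F) b (i p)) huv).trans (h3 v).symm)

end Immersion

/-! ### The Riemannian metric in a chart. -/

section Charts

variable {E : Type*} [NormedAddCommGroup E] [NormedSpace ℝ E]
  {M : Type*} [TopologicalSpace M] [ChartedSpace E M] [IsManifold 𝓘(ℝ, E) ∞ M]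

theorem isManifold_one : IsManifold 𝓘(ℝ, E) 1 M := IsManifold.of_le (n := ∞) (by norm_cast)

theorem contMDiffAt_extChartAt_symm (p : M) {x : E} (hx : x ∈ (extChartAt 𝓘(ℝ, E) p).target) :
    ContMDiffAt 𝓘(ℝ, E) 𝓘(ℝ, E) ∞ (extChartAt 𝓘(ℝ, E) p).symm x :=
  (contMDiffOn_extChartAt_symm p).contMDiffAt ((isOpen_extChartAt_target p).mem_nhds hx)

theorem isInvertible_mfderiv_extChartAt_symm (p : M) {x : E}
    (hx : x ∈ (extChartAt 𝓘(ℝ, E) p).target) :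
    (mfderiv 𝓘(ℝ, E) 𝓘(ℝ, E) (extChartAt 𝓘(ℝ, E) p).symm x).IsInvertible := by
  have := isManifold_one (E := E) (M := M)
  have h := isInvertible_mfderivWithin_extChartAt_symm hx
  rwa [modelWithCornersSelf_coe, Set.range_id, mfderivWithin_univ] at h

theorem mfderiv_extChartAt_symm_comp (p : M) {y : M} (hy : y ∈ (extChartAt 𝓘(ℝ, E) p).source)
    (v : TangentSpace 𝓘(ℝ, E) y) :
    (mfderiv 𝓘(ℝ, E) 𝓘(ℝ, E) (extChartAt 𝓘(ℝ, E) p).symm (extChartAt 𝓘(ℝ, E) p y)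
      (mfderiv 𝓘(ℝ, E) 𝓘(ℝ, E) (extChartAt 𝓘(ℝ, E) p) y v) : E) = v := by
  have := isManifold_one (E := E) (M := M)
  have h := mfderivWithin_extChartAt_symm_comp_mfderiv_extChartAt' hy
  rw [modelWithCornersSelf_coe, Set.range_id, mfderivWithin_univ] at h
  exact congrArg (fun L ↦ L v) h

variable [RiemannianBundle (fun x : M ↦ TangentSpace 𝓘(ℝ, E) x)]

omit [IsManifold 𝓘(ℝ, E) ∞ M] in
theorem metricCoord_apply (p : M) (x u v : E) : metricCoord p x u v =
    inner ℝ (mfderiv 𝓘(ℝ, E) 𝓘(ℝ, E) (extChartAt 𝓘(ℝ, E) p).symm x u)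
      (mfderiv 𝓘(ℝ, E) 𝓘(ℝ, E) (extChartAt 𝓘(ℝ, E) p).symm x v) := rfl

omit [IsManifold 𝓘(ℝ, E) ∞ M] in
theorem metricCoord_symm (p : M) (x u v : E) : metricCoord p x u v = metricCoord p x v u := by
  rw [metricCoord_apply, metricCoord_apply, real_inner_comm]

theorem isInvertible_metricCoord [FiniteDimensional ℝ E] (p : M) {x : E}
    (hx : x ∈ (extChartAt 𝓘(ℝ, E) p).target) : (metricCoord p x).IsInvertible := by
  have hinj : Function.Injective (metricCoord p x).toLinearMap := by
    rw [← LinearMap.ker_eq_bot, LinearMap.ker_eq_bot']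
    intro u hu
    have h1 : metricCoord p x u u = 0 := congrArg (fun L : E →L[ℝ] ℝ ↦ L u) hu
    rw [metricCoord_apply, inner_self_eq_zero] at h1
    exact (isInvertible_mfderiv_extChartAt_symm p hx).injective (h1.trans (map_zero _).symm)
  have hdim : Module.finrank ℝ E = Module.finrank ℝ (E →L[ℝ] ℝ) := by
    rw [← LinearMap.toContinuousLinearMap (𝕜 := ℝ) (E := E) (F' := ℝ) |>.finrank_eq]
    exact (Subspace.dual_finrank_eq (K := ℝ) (V := E)).symm
  let e := (LinearEquiv.ofInjectiveOfFinrankEq _ hinj hdim).toContinuousLinearEquiv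
  exact ⟨e, by ext; rfl⟩

/-- In finite dimension it suffices to test on constant vectors `u, v`; the inverse chart pushes
these to smooth fields along it, whose inner product is smooth. -/
theorem contDiffOn_metricCoord [FiniteDimensional ℝ E]
    [IsContMDiffRiemannianBundle 𝓘(ℝ, E) ∞ E (fun x : M ↦ TangentSpace 𝓘(ℝ, E) x)] (p : M) :
    ContDiffOn ℝ ∞ (metricCoord p) (extChartAt 𝓘(ℝ, E) p).target := by
  have := isManifold_one (E := E) (M := M)
  have hopen := isOpen_extChartAt_target (I := 𝓘(ℝ, E)) p
  have hT := (contMDiffOn_extChartAt_symm (I := 𝓘(ℝ, E)) (n := ∞) p).contMDiffOn_tangentMapWithin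
    (m := ∞) (by simp) hopen.uniqueMDiffOn
  have hs : ∀ u : E, ContMDiffOn 𝓘(ℝ, E) 𝓘(ℝ, E).tangent ∞
      (fun x ↦ (⟨(extChartAt 𝓘(ℝ, E) p).symm x,
        mfderiv 𝓘(ℝ, E) 𝓘(ℝ, E) (extChartAt 𝓘(ℝ, E) p).symm x u⟩ : TangentBundle 𝓘(ℝ, E) M))
      (extChartAt 𝓘(ℝ, E) p).target := by
    intro u
    have hc : ContMDiff 𝓘(ℝ, E) 𝓘(ℝ, E).tangent ∞
        (fun x : E ↦ (⟨x, u⟩ : TangentBundle 𝓘(ℝ, E) E)) :=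
      contMDiff_vectorSpace_iff_contDiff.2 contDiff_const
    refine (hT.comp hc.contMDiffOn fun x hx ↦ hx).congr fun x hx ↦ ?_
    simp only [Function.comp_apply, tangentMapWithin]
    rw [mfderivWithin_of_isOpen hopen hx]
  refine contDiffOn_clm_apply.2 fun u ↦ contDiffOn_clm_apply.2 fun v ↦ ?_
  have key := ContMDiffOn.inner_bundle (IB := 𝓘(ℝ, E)) (n := ∞) (F := E)
    (E := fun x : M ↦ TangentSpace 𝓘(ℝ, E) x) (IM := 𝓘(ℝ, E))
    (b := (extChartAt 𝓘(ℝ, E) p).symm) (s := (extChartAt 𝓘(ℝ, E) p).target)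
    (v := fun x ↦ mfderiv 𝓘(ℝ, E) 𝓘(ℝ, E) (extChartAt 𝓘(ℝ, E) p).symm x u)
    (w := fun x ↦ mfderiv 𝓘(ℝ, E) 𝓘(ℝ, E) (extChartAt 𝓘(ℝ, E) p).symm x v)
  exact (key (hs u) (hs v)).contDiffOn

/-- The inner product of `T_qM`, on elements of the model space. -/
def tangentInner (q : M) (a b : TangentSpace 𝓘(ℝ, E) q) : ℝ := inner ℝ a b

theorem metricCoord_mfderiv_extChartAt (p : M) {y : M} (hy : y ∈ (extChartAt 𝓘(ℝ, E) p).source)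
    (u v : TangentSpace 𝓘(ℝ, E) y) :
    metricCoord p (extChartAt 𝓘(ℝ, E) p y) (mfderiv 𝓘(ℝ, E) 𝓘(ℝ, E) (extChartAt 𝓘(ℝ, E) p) y u)
      (mfderiv 𝓘(ℝ, E) 𝓘(ℝ, E) (extChartAt 𝓘(ℝ, E) p) y v) = inner ℝ u v := by
  have hu := mfderiv_extChartAt_symm_comp p hy u
  have hv := mfderiv_extChartAt_symm_comp p hy v
  -- The point `φ⁻¹(φ(y))` equals `y` only propositionally, so the base point is generalized before
  -- substituting.
  have h1 : ∀ q : M, q = y → ∀ a b : E, a = u → b = v →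
      tangentInner q a b = inner ℝ u v := by
    rintro q rfl a b rfl rfl
    rfl
  exact h1 _ ((extChartAt 𝓘(ℝ, E) p).left_inv hy) _ _ hu hv

end Charts

/-! ### The immersion and the Killing fields in charts. -/

section ChartExpression

variable {E F : Type*} [NormedAddCommGroup E] [NormedSpace ℝ E]
  [NormedAddCommGroup F] [NormedSpace ℝ F]
  {M : Type*} [TopologicalSpace M] [ChartedSpace F M] [IsManifold 𝓘(ℝ, F) ∞ M]
  {N : Type*} [TopologicalSpace N] [ChartedSpace E N] [IsManifold 𝓘(ℝ, E) ∞ N]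
  {i : N → M}

variable (E F) in
/-- The expression of `i : N → M` in the charts around `p` and `i p`. -/
def chartMap (i : N → M) (p : N) (y : E) : F :=
  extChartAt 𝓘(ℝ, F) (i p) (i ((extChartAt 𝓘(ℝ, E) p).symm y))

variable (E F) in
/-- The domain of the expression of `i : N → M` in the charts around `p` and `i p`. -/
def chartDomain (i : N → M) (p : N) : Set E :=
  (extChartAt 𝓘(ℝ, E) p).target ∩
    (extChartAt 𝓘(ℝ, E) p).symm ⁻¹' (i ⁻¹' (extChartAt 𝓘(ℝ, F) (i p)).source)

omit [IsManifold 𝓘(ℝ, F) ∞ M] [IsManifold 𝓘(ℝ, E) ∞ N] in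
theorem isOpen_chartDomain (hi : Continuous i) (p : N) : IsOpen (chartDomain E F i p) :=
  (continuousOn_extChartAt_symm p).isOpen_inter_preimage (isOpen_extChartAt_target p)
    ((isOpen_extChartAt_source (i p)).preimage hi)

omit [IsManifold 𝓘(ℝ, F) ∞ M] [IsManifold 𝓘(ℝ, E) ∞ N] in
theorem mem_chartDomain (p : N) : extChartAt 𝓘(ℝ, E) p p ∈ chartDomain E F i p :=
  ⟨mem_extChartAt_target p, by
    rw [Set.mem_preimage, extChartAt_to_inv]
    exact mem_extChartAt_source (i p)⟩

theorem contDiffAt_chartMap (hi : ContMDiff 𝓘(ℝ, E) 𝓘(ℝ, F) ∞ i) (p : N) {y : E}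
    (hy : y ∈ chartDomain E F i p) : ContDiffAt ℝ ∞ (chartMap E F i p) y := by
  have h1 := contMDiffAt_extChartAt_symm p hy.1
  have h2 : ContMDiffAt 𝓘(ℝ, F) 𝓘(ℝ, F) ∞ (extChartAt 𝓘(ℝ, F) (i p))
      (i ((extChartAt 𝓘(ℝ, E) p).symm y)) := contMDiffAt_extChartAt' (by simpa using hy.2)
  exact (h2.comp y ((hi _).comp y h1)).contDiffAt

theorem fderiv_chartMap (hi : ContMDiff 𝓘(ℝ, E) 𝓘(ℝ, F) ∞ i) (p : N) {y : E}
    (hy : y ∈ chartDomain E F i p) (w : E) :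
    fderiv ℝ (chartMap E F i p) y w =
      mfderiv 𝓘(ℝ, F) 𝓘(ℝ, F) (extChartAt 𝓘(ℝ, F) (i p)) (i ((extChartAt 𝓘(ℝ, E) p).symm y))
        (mfderiv 𝓘(ℝ, E) 𝓘(ℝ, F) i ((extChartAt 𝓘(ℝ, E) p).symm y)
          (mfderiv 𝓘(ℝ, E) 𝓘(ℝ, E) (extChartAt 𝓘(ℝ, E) p).symm y w)) := by
  have h1 := (contMDiffAt_extChartAt_symm p hy.1).mdifferentiableAt (by simp)
  have h2 : ContMDiffAt 𝓘(ℝ, F) 𝓘(ℝ, F) ∞ (extChartAt 𝓘(ℝ, F) (i p))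
      (i ((extChartAt 𝓘(ℝ, E) p).symm y)) := contMDiffAt_extChartAt' (by simpa using hy.2)
  have h3 := (hi ((extChartAt 𝓘(ℝ, E) p).symm y)).mdifferentiableAt (by simp)
  have e1 := mfderiv_comp y (h2.mdifferentiableAt (by simp)) (h3.comp y h1)
  have e2 := mfderiv_comp y h3 h1
  rw [e2] at e1
  have e3 : mfderiv 𝓘(ℝ, E) 𝓘(ℝ, F) (chartMap E F i p) y = fderiv ℝ (chartMap E F i p) y :=
    mfderiv_eq_fderiv
  exact congrArg (fun L ↦ L w) (e3.symm.trans e1)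

variable [RiemannianBundle (fun x : M ↦ TangentSpace 𝓘(ℝ, F) x)]

theorem metricCoord_chartMap (hi : ContMDiff 𝓘(ℝ, E) 𝓘(ℝ, F) ∞ i) (p : N) {y : E}
    (hy : y ∈ chartDomain E F i p) (v w : E) :
    metricCoord (i p) (chartMap E F i p y) (fderiv ℝ (chartMap E F i p) y v)
      (fderiv ℝ (chartMap E F i p) y w) =
    inducedMetric (E := E) (F := F) i ((extChartAt 𝓘(ℝ, E) p).symm y)
      (mfderiv 𝓘(ℝ, E) 𝓘(ℝ, E) (extChartAt 𝓘(ℝ, E) p).symm y v)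
      (mfderiv 𝓘(ℝ, E) 𝓘(ℝ, E) (extChartAt 𝓘(ℝ, E) p).symm y w) := by
  rw [fderiv_chartMap hi p hy v, fderiv_chartMap hi p hy w]
  exact metricCoord_mfderiv_extChartAt (i p) hy.2 _ _

variable [FiniteDimensional ℝ F]
  [IsContMDiffRiemannianBundle 𝓘(ℝ, F) ∞ F (fun x : M ↦ TangentSpace 𝓘(ℝ, F) x)]

theorem isMetricAlong_chartMap (hi : ContMDiff 𝓘(ℝ, E) 𝓘(ℝ, F) ∞ i) (p : N) :
    IsMetricAlong (metricCoord (E := F) (i p)) (chartMap E F i p) (chartDomain E F i p) where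
  isOpen := isOpen_chartDomain hi.continuous p
  contDiffAt_map _ hy := contDiffAt_chartMap hi p hy
  contDiffAt_metric _ hy := (contDiffOn_metricCoord (i p)).contDiffAt
    ((isOpen_extChartAt_target (i p)).mem_nhds ((extChartAt 𝓘(ℝ, F) (i p)).map_source hy.2))
  symm _ _ := Eventually.of_forall fun z u v ↦ metricCoord_symm (i p) z u v
  isInvertible _ hy := isInvertible_metricCoord (i p) ((extChartAt 𝓘(ℝ, F) (i p)).map_source hy.2)

omit [FiniteDimensional ℝ F] in
theorem contMDiff_inducedMetric (hi : ContMDiff 𝓘(ℝ, E) 𝓘(ℝ, F) ∞ i)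
    {Y Z : (x : N) → TangentSpace 𝓘(ℝ, E) x}
    (hY : ContMDiff 𝓘(ℝ, E) 𝓘(ℝ, E).tangent ∞ (fun x ↦ (⟨x, Y x⟩ : TangentBundle 𝓘(ℝ, E) N)))
    (hZ : ContMDiff 𝓘(ℝ, E) 𝓘(ℝ, E).tangent ∞ (fun x ↦ (⟨x, Z x⟩ : TangentBundle 𝓘(ℝ, E) N))) :
    ContMDiff 𝓘(ℝ, E) 𝓘(ℝ, ℝ) ∞ fun x ↦ inducedMetric (E := E) (F := F) i x (Y x) (Z x) := by
  have := isManifold_one (E := F) (M := M)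
  have := isManifold_one (E := E) (M := N)
  have hT := hi.contMDiff_tangentMap (m := ∞) (by simp)
  have key := ContMDiff.inner_bundle (IB := 𝓘(ℝ, F)) (n := ∞) (F := F)
    (E := fun x : M ↦ TangentSpace 𝓘(ℝ, F) x) (IM := 𝓘(ℝ, E)) (b := i)
    (v := fun x ↦ mfderiv 𝓘(ℝ, E) 𝓘(ℝ, F) i x (Y x))
    (w := fun x ↦ mfderiv 𝓘(ℝ, E) 𝓘(ℝ, F) i x (Z x))
  exact key (hT.comp hY) (hT.comp hZ)

omit [IsManifold 𝓘(ℝ, E) ∞ N] [FiniteDimensional ℝ F]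
  [IsContMDiffRiemannianBundle 𝓘(ℝ, F) ∞ F (fun x : M ↦ TangentSpace 𝓘(ℝ, F) x)] in
theorem inducedMetric_zero_left (x : N) (v : TangentSpace 𝓘(ℝ, E) x) :
    inducedMetric (E := E) (F := F) i x 0 v = 0 := by
  rw [inducedMetric]
  exact (congrArg (fun a ↦ inner ℝ a _) (map_zero _)).trans (inner_zero_left _)

omit [IsManifold 𝓘(ℝ, E) ∞ N] [FiniteDimensional ℝ F]
  [IsContMDiffRiemannianBundle 𝓘(ℝ, F) ∞ F (fun x : M ↦ TangentSpace 𝓘(ℝ, F) x)] in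
theorem inducedMetric_zero_right (x : N) (v : TangentSpace 𝓘(ℝ, E) x) :
    inducedMetric (E := E) (F := F) i x v 0 = 0 := by
  rw [inducedMetric]
  exact (congrArg (fun a ↦ inner ℝ _ a) (map_zero _)).trans (inner_zero_right _)

/-- The expression of a vector field in the chart around `p`. -/
def chartField (p : N) (X : (x : N) → TangentSpace 𝓘(ℝ, E) x) (y : E) : E :=
  VectorField.mpullback 𝓘(ℝ, E) 𝓘(ℝ, E) (extChartAt 𝓘(ℝ, E) p).symm X y

theorem mfderiv_chartField (p : N) {y : E} (hy : y ∈ (extChartAt 𝓘(ℝ, E) p).target)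
    (X : (x : N) → TangentSpace 𝓘(ℝ, E) x) :
    mfderiv 𝓘(ℝ, E) 𝓘(ℝ, E) (extChartAt 𝓘(ℝ, E) p).symm y (chartField (E := E) p X y) =
      X ((extChartAt 𝓘(ℝ, E) p).symm y) := by
  rw [chartField, VectorField.mpullback_apply]
  exact (isInvertible_mfderiv_extChartAt_symm p hy).self_apply_inverse _

variable [FiniteDimensional ℝ E]

omit [FiniteDimensional ℝ F] in
-- Pullback by the inverse chart respects smoothness and brackets; constancy of inner products is
-- the Killing equation for commuting fields, carried over by the chain rule.
theorem isParallelFamily_chartField (hi : ContMDiff 𝓘(ℝ, E) 𝓘(ℝ, F) ∞ i) (p : N)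
    {ι : Type*} {X : ι → (x : N) → TangentSpace 𝓘(ℝ, E) x}
    (hX : ∀ a, IsKillingField (inducedMetric (E := E) (F := F) i) (X a))
    (hcomm : ∀ a b x, VectorField.mlieBracket 𝓘(ℝ, E) (X a) (X b) x = 0) :
    IsParallelFamily (metricCoord (E := F) (i p)) (chartMap E F i p) (chartDomain E F i p)
      (Set.range fun a ↦ chartField p (X a)) := by
  have := isManifold_one (E := E) (M := N)
  have : IsManifold 𝓘(ℝ, E) (minSmoothness ℝ 2) N :=
    IsManifold.of_le (n := ∞) (by simp only [minSmoothness_of_isRCLikeNormedField]; norm_cast)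
  have hcomplete : CompleteSpace E := FiniteDimensional.complete ℝ E
  constructor
  · rintro _ ⟨a, rfl⟩ y hy
    exact contMDiffAt_vectorSpace_iff_contDiffAt.1 <|
      ContMDiffAt.mpullback_vectorField_preimage ((hX a).smooth _)
        (contMDiffAt_extChartAt_symm p hy.1) (isInvertible_mfderiv_extChartAt_symm p hy.1) (by simp)
  · rintro _ ⟨a, rfl⟩ _ ⟨b, rfl⟩ y hy
    have h := VectorField.mpullback_mlieBracket (x₀ := y)
      (((hX a).smooth ((extChartAt 𝓘(ℝ, E) p).symm y)).mdifferentiableAt (by simp))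
      (((hX b).smooth _).mdifferentiableAt (by simp)) (contMDiffAt_extChartAt_symm p hy.1)
      (by simp only [minSmoothness_of_isRCLikeNormedField]; norm_cast)
    rw [VectorField.mpullback_apply, hcomm, map_zero, ← VectorField.mlieBracketWithin_univ,
      VectorField.mlieBracketWithin_eq_lieBracketWithin] at h
    rw [← VectorField.lieBracketWithin_univ]
    exact h.symm
  · rintro _ ⟨a, rfl⟩ _ ⟨b, rfl⟩ _ ⟨c, rfl⟩ y hy
    have hH := contMDiff_inducedMetric hi (hX b).smooth (hX c).smooth
    set H : N → ℝ := fun x ↦ inducedMetric (E := E) (F := F) i x (X b x) (X c x)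
    have e1 : (fun z ↦ metricCoord (i p) (chartMap E F i p z)
        (fderiv ℝ (chartMap E F i p) z (chartField p (X b) z))
        (fderiv ℝ (chartMap E F i p) z (chartField p (X c) z))) =ᶠ[𝓝 y]
        H ∘ (extChartAt 𝓘(ℝ, E) p).symm := by
      filter_upwards [(isOpen_chartDomain hi.continuous p).mem_nhds hy] with z hz
      exact (metricCoord_chartMap hi p hz _ _).trans <|
        congrArg₂ (inducedMetric (E := E) (F := F) i ((extChartAt 𝓘(ℝ, E) p).symm z))
          (mfderiv_chartField p hz.1 _) (mfderiv_chartField p hz.1 _)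
    have e2 := mfderiv_comp y ((hH _).mdifferentiableAt (by simp))
      ((contMDiffAt_extChartAt_symm p hy.1).mdifferentiableAt (by simp))
    have e3 := (hX a).lieDerivative_eq_zero ((extChartAt 𝓘(ℝ, E) p).symm y) (X b) (X c)
      ((hX b).smooth _) ((hX c).smooth _)
    rw [hcomm, hcomm, inducedMetric_zero_left, inducedMetric_zero_right, add_zero] at e3
    have e4 : mfderiv 𝓘(ℝ, E) 𝓘(ℝ, ℝ) (H ∘ (extChartAt 𝓘(ℝ, E) p).symm) y =
      fderiv ℝ (H ∘ (extChartAt 𝓘(ℝ, E) p).symm) y := mfderiv_eq_fderiv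
    rw [e1.fderiv_eq]
    exact (congrArg (fun L ↦ L (chartField (E := E) p (X a) y)) (e4.symm.trans e2)).trans <|
      (congrArg (mfderiv 𝓘(ℝ, E) 𝓘(ℝ, ℝ) H ((extChartAt 𝓘(ℝ, E) p).symm y))
        (mfderiv_chartField p hy.1 (X a))).trans e3

end ChartExpression

/-! ### The Gauss equation at `p` and the sign of `Ric_k`. -/

section Gauss

variable {F : Type*} [NormedAddCommGroup F] [NormedSpace ℝ F]
  {M : Type*} [TopologicalSpace M] [ChartedSpace F M] [IsManifold 𝓘(ℝ, F) ∞ M]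
  [RiemannianBundle (fun x : M ↦ TangentSpace 𝓘(ℝ, F) x)]

omit [IsManifold 𝓘(ℝ, F) ∞ M] [RiemannianBundle (fun x : M ↦ TangentSpace 𝓘(ℝ, F) x)] in
theorem finiteDimensional_tangentSpace [FiniteDimensional ℝ F] (q : M) :
    FiniteDimensional ℝ (TangentSpace 𝓘(ℝ, F) q) :=
  inferInstanceAs (FiniteDimensional ℝ F)

omit [IsManifold 𝓘(ℝ, F) ∞ M] in
-- In an orthonormal basis of `V` the trace is a sum of terms `⟨e, R(e, u)u⟩`; the projection drops
-- out because `e ∈ V`.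
theorem intermediateRicci_nonpos [FiniteDimensional ℝ F] (q : M) (u : TangentSpace 𝓘(ℝ, F) q)
    (V : Submodule ℝ (TangentSpace 𝓘(ℝ, F) q))
    (h : ∀ x ∈ V, inner ℝ x (curvature q x u u) ≤ 0) : intermediateRicci q u V ≤ 0 := by
  have := finiteDimensional_tangentSpace (F := F) q
  rw [intermediateRicci, LinearMap.trace_eq_sum_inner _ (stdOrthonormalBasis ℝ V)]
  refine Finset.sum_nonpos fun j _ ↦ ?_
  have h1 := h _ (stdOrthonormalBasis ℝ V j).2
  rw [LinearMap.comp_apply, LinearMap.comp_apply]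
  exact (Submodule.inner_orthogonalProjectionOnto_eq_of_mem_left _ _).trans_le h1

theorem metricCoord_chartDeriv (q : M) (u v : TangentSpace 𝓘(ℝ, F) q) :
    metricCoord q (extChartAt 𝓘(ℝ, F) q q) (chartDeriv q u) (chartDeriv q v) = inner ℝ u v :=
  metricCoord_mfderiv_extChartAt q (mem_extChartAt_source q) u v

omit [RiemannianBundle (fun x : M ↦ TangentSpace 𝓘(ℝ, F) x)] in
theorem isInvertible_chartDeriv (q : M) : (chartDeriv (E := F) q).IsInvertible := by
  have := isManifold_one (E := F) (M := M)
  exact isInvertible_mfderiv_extChartAt (mem_extChartAt_source q)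

theorem inner_inverse_chartDeriv (q : M) (a : F) (v : TangentSpace 𝓘(ℝ, F) q) :
    inner ℝ ((chartDeriv q).inverse a) v =
      metricCoord q (extChartAt 𝓘(ℝ, F) q q) a (chartDeriv q v) := by
  rw [← metricCoord_chartDeriv, (isInvertible_chartDeriv q).self_apply_inverse]

theorem inner_inverse_chartDeriv_inverse (q : M) (a b : F) :
    (inner ℝ ((chartDeriv q).inverse a) ((chartDeriv q).inverse b) : ℝ) =
      metricCoord q (extChartAt 𝓘(ℝ, F) q q) a b := by
  rw [inner_inverse_chartDeriv, (isInvertible_chartDeriv q).self_apply_inverse]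

variable {E : Type*} [NormedAddCommGroup E] [NormedSpace ℝ E]
  {N : Type*} [TopologicalSpace N] [ChartedSpace E N] [IsManifold 𝓘(ℝ, E) ∞ N]
  {i : N → M}

/-- `T_pN` is identified with `E` through the preferred chart at `p`, so the differential of that
chart's inverse at the base point is the identity. -/
theorem mfderiv_extChartAt_symm_self (p : N) (w : E) :
    (mfderiv 𝓘(ℝ, E) 𝓘(ℝ, E) (extChartAt 𝓘(ℝ, E) p).symm (extChartAt 𝓘(ℝ, E) p p) w : E) = w := by
  have := isManifold_one (E := E) (M := N)
  have h := mfderivWithin_range_extChartAt_symm (I := 𝓘(ℝ, E)) (x := p)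
  rw [modelWithCornersSelf_coe, Set.range_id, mfderivWithin_univ] at h
  exact congrArg (fun L ↦ L w) h

theorem chartField_self (p : N) (X : (x : N) → TangentSpace 𝓘(ℝ, E) x) :
    chartField (E := E) p X (extChartAt 𝓘(ℝ, E) p p) = X p := by
  have h1 := mfderiv_chartField p (mem_extChartAt_target p) X
  have h2 : ∀ q : N, q = p → (X q : E) = X p := by
    rintro q rfl
    rfl
  exact ((mfderiv_extChartAt_symm_self p _).symm.trans h1).trans
    (h2 _ ((extChartAt 𝓘(ℝ, E) p).left_inv (mem_extChartAt_source p)))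

omit [IsManifold 𝓘(ℝ, F) ∞ M] [RiemannianBundle (fun x : M ↦ TangentSpace 𝓘(ℝ, F) x)]
  [IsManifold 𝓘(ℝ, E) ∞ N] in
theorem chartMap_self (p : N) :
    chartMap E F i p (extChartAt 𝓘(ℝ, E) p p) = extChartAt 𝓘(ℝ, F) (i p) (i p) := by
  rw [chartMap, extChartAt_to_inv]

omit [RiemannianBundle (fun x : M ↦ TangentSpace 𝓘(ℝ, F) x)] in
theorem fderiv_chartMap_self (hi : ContMDiff 𝓘(ℝ, E) 𝓘(ℝ, F) ∞ i) (p : N)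
    (w : E) :
    fderiv ℝ (chartMap E F i p) (extChartAt 𝓘(ℝ, E) p p) w =
      chartDeriv (i p) (mfderiv 𝓘(ℝ, E) 𝓘(ℝ, F) i p w) := by
  have h1 := fderiv_chartMap hi p (mem_chartDomain p) w
  have h2 : ∀ q : N, q = p → ∀ v : E, v = w →
      (mfderiv 𝓘(ℝ, F) 𝓘(ℝ, F) (extChartAt 𝓘(ℝ, F) (i p)) (i q)
        (mfderiv 𝓘(ℝ, E) 𝓘(ℝ, F) i q v) : F) =
      chartDeriv (i p) (mfderiv 𝓘(ℝ, E) 𝓘(ℝ, F) i p w) := by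
    rintro q rfl v rfl
    rfl
  exact h1.trans (h2 _ ((extChartAt 𝓘(ℝ, E) p).left_inv (mem_extChartAt_source p)) _
    (mfderiv_extChartAt_symm_self p w))

/-- The second fundamental form at `p` of an immersed submanifold whose tangent space at `p` is
spanned by commuting Killing fields, together with its Gauss equation. -/
theorem exists_secondFundamentalForm [FiniteDimensional ℝ E] [FiniteDimensional ℝ F]
    [IsContMDiffRiemannianBundle 𝓘(ℝ, F) ∞ F (fun x : M ↦ TangentSpace 𝓘(ℝ, F) x)]
    (hi : Manifold.IsImmersion 𝓘(ℝ, E) 𝓘(ℝ, F) ∞ i) (p : N)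
    {ι : Type*} {X : ι → (x : N) → TangentSpace 𝓘(ℝ, E) x}
    (hX : ∀ a, IsKillingField (inducedMetric (E := E) (F := F) i) (X a))
    (hcomm : ∀ a b x, VectorField.mlieBracket 𝓘(ℝ, E) (X a) (X b) x = 0)
    (hspan : Submodule.span ℝ (Set.range fun a ↦ X a p) = ⊤)
    {S : Submodule ℝ (TangentSpace 𝓘(ℝ, F) (i p))}
    (hS : S = LinearMap.range (mfderiv 𝓘(ℝ, E) 𝓘(ℝ, F) i p).toLinearMap) :
    Module.finrank ℝ S = Module.finrank ℝ E ∧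
    ∃ α : S →ₗ[ℝ] S →ₗ[ℝ] TangentSpace 𝓘(ℝ, F) (i p), (∀ v w, α v w = α w v) ∧
      (∀ v w, α v w ∈ Sᗮ) ∧
      ∀ x u : S,
        inner ℝ (x : TangentSpace 𝓘(ℝ, F) (i p)) (curvature (E := F) (i p) x u u) =
        ‖α u x‖ ^ 2 - inner ℝ (α u u) (α x x) := by
  subst hS
  have hcomplete : CompleteSpace F := FiniteDimensional.complete ℝ F
  have hism := hi.contMDiff
  obtain ⟨α, hsymm, hnormal, hgauss⟩ :=
    (isParallelFamily_chartField hism p hX hcomm).exists_bilinear (isMetricAlong_chartMap hism p)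
      (mem_chartDomain p) (by
        rw [← Set.range_comp]
        refine Eq.trans ?_ hspan
        congr 2
        funext a
        exact chartField_self p (X a))
  rw [chartMap_self] at hnormal hgauss
  let e : TangentSpace 𝓘(ℝ, E) p ≃ₗ[ℝ]
      LinearMap.range (mfderiv 𝓘(ℝ, E) 𝓘(ℝ, F) i p).toLinearMap :=
    LinearEquiv.ofInjective _ (mfderiv_injective_of_isImmersionAt (hi.isImmersionAt p))
  have he : ∀ s, mfderiv 𝓘(ℝ, E) 𝓘(ℝ, F) i p (e.symm s) = s := fun s ↦
    congrArg Subtype.val (e.apply_symm_apply s)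
  have hD : ∀ s, fderiv ℝ (chartMap E F i p) (extChartAt 𝓘(ℝ, E) p p) (e.symm s) =
      chartDeriv (E := F) (i p) s := fun s ↦ by
    rw [← he s]
    exact fderiv_chartMap_self hism p _
  let L : F →ₗ[ℝ] TangentSpace 𝓘(ℝ, F) (i p) := (chartDeriv (i p)).inverse.toLinearMap
  let e' : LinearMap.range (mfderiv 𝓘(ℝ, E) 𝓘(ℝ, F) i p).toLinearMap →ₗ[ℝ] E := e.symm.toLinearMap
  -- The coordinate form `α`, transported to the image of `di_p` in its arguments and to `T_{i(p)}M`
  -- in its values.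
  let β := (α.compl₁₂ e' e').compr₂ L
  have hβ : ∀ v w, β v w = (chartDeriv (i p)).inverse (α (e' v) (e' w)) := fun _ _ ↦ rfl
  refine ⟨(LinearEquiv.finrank_eq e).symm, β, fun v w ↦ ?_, fun v w ↦ ?_, fun x u ↦ ?_⟩
  · rw [hβ, hβ, hsymm]
  · rw [Submodule.mem_orthogonal']
    intro s hs
    rw [hβ, inner_inverse_chartDeriv]
    have := hnormal (e' v) (e' w) (e' ⟨s, hs⟩)
    rwa [show fderiv ℝ (chartMap E F i p) (extChartAt 𝓘(ℝ, E) p p) (e' ⟨s, hs⟩) =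
      chartDeriv (E := F) (i p) s from hD ⟨s, hs⟩] at this
  · rw [real_inner_comm, curvature, inner_inverse_chartDeriv, ← real_inner_self_eq_norm_sq, hβ, hβ,
      hβ, inner_inverse_chartDeriv_inverse, inner_inverse_chartDeriv_inverse, ← hgauss]
    rw [show fderiv ℝ (chartMap E F i p) (extChartAt 𝓘(ℝ, E) p p) (e' u) =
      chartDeriv (E := F) (i p) u from hD u, show fderiv ℝ (chartMap E F i p) (extChartAt 𝓘(ℝ, E) p p)
      (e' x) = chartDeriv (E := F) (i p) x from hD x]

end Gauss

end LocalSymmetryRank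

end

theorem theoremB {n d k : ℕ}
    {M : Type*} [TopologicalSpace M] [ChartedSpace (EuclideanSpace ℝ (Fin n)) M]
    [IsManifold (𝓡 n) ∞ M]
    [RiemannianBundle (fun x : M ↦ TangentSpace (𝓡 n) x)]
    [IsContMDiffRiemannianBundle (𝓡 n) ∞ (EuclideanSpace ℝ (Fin n))
      (fun x : M ↦ TangentSpace (𝓡 n) x)]
    {N : Type*} [TopologicalSpace N] [ChartedSpace (EuclideanSpace ℝ (Fin d)) N]
    [IsManifold (𝓡 d) ∞ N]
    (i : N → M) (hi : Manifold.IsImmersion (𝓡 d) (𝓡 n) ∞ i) (p : N)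
    {ι : Type*} (X : ι → (x : N) → TangentSpace (𝓡 d) x)
    (hX : ∀ a, LocalSymmetryRank.IsKillingField
      (LocalSymmetryRank.inducedMetric (E := EuclideanSpace ℝ (Fin d))
        (F := EuclideanSpace ℝ (Fin n)) i) (X a))
    (hcomm : ∀ a b x, VectorField.mlieBracket (𝓡 d) (X a) (X b) x = 0)
    (hspan : Submodule.span ℝ (Set.range fun a ↦ X a p) = ⊤)
    (hk : 1 ≤ k) (hkn : k + 2 ≤ n)
    (hRic : ∀ (V : Submodule ℝ (TangentSpace (𝓡 n) (i p))),
      V ≤ LinearMap.range (mfderiv (𝓡 d) (𝓡 n) i p).toLinearMap →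
      Module.finrank ℝ V = k + 1 →
      ∀ u ∈ V, ‖u‖ = 1 → 0 < LocalSymmetryRank.intermediateRicci (i p) u V) :
    d ≤ (n + k) / 2 := by
  -- With the floor, failure of the bound means exactly `n + k + 1 ≤ 2 * d`, the hypothesis of the
  -- algebraic lemma.
  by_contra! hlt
  have := LocalSymmetryRank.finiteDimensional_tangentSpace (F := EuclideanSpace ℝ (Fin n)) (i p)
  have hT : Module.finrank ℝ (TangentSpace (𝓡 n) (i p)) = n :=
    finrank_euclideanSpace_fin (𝕜 := ℝ) (n := n)
  obtain ⟨S, hS⟩ : ∃ S, S = LinearMap.range (mfderiv (𝓡 d) (𝓡 n) i p).toLinearMap := ⟨_, rfl⟩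
  obtain ⟨hdim, α, hsymm, hnormal, hgauss⟩ :=
    LocalSymmetryRank.exists_secondFundamentalForm hi p hX hcomm hspan hS
  rw [finrank_euclideanSpace_fin] at hdim
  obtain ⟨u, V, hu, huV, hV, hle⟩ :=
    LocalSymmetryRank.exists_submodule_forall_norm_sq_le_inner S α hsymm hnormal (k := k)
      (by omega)
  refine (hRic (V.map S.subtype) (hS ▸ S.map_subtype_le V) ?_ u (Submodule.mem_map_of_mem huV)
    hu).not_ge (LocalSymmetryRank.intermediateRicci_nonpos _ _ _ ?_)
  · rw [← hV]
    exact LinearEquiv.finrank_eq (Submodule.equivSubtypeMap S V).symm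
  · rintro _ ⟨x, hx, rfl⟩
    refine (hgauss x u).trans_le ?_
    linarith [hle x hx]
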